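/- Let $Y\ge 0$ be a random variable with $\mathbb{E}\,Y<\infty$ and $\mathbb{P}(Y>0)>0$. For every integer $k\ge 1$ let $X_k$ be a $\Gamma(k,1)$-distributed random variable (density $x^{k-1}e^{-x}/\Gamma(k)$ on $(0,\infty)$), defined on the same probability space and independent of $Y$, and set $Z_k=Y/X_k$. Let $\{\cdot\}$ denote the fractional part and let $\chi$ be the indicator function of $(0,1)$. Then: (i) $(Z_k)_{k\ge1}$ verifies gNB, that is, there exist real coefficients $(c_{k,n})_{1\le k\le n,\ n\ge1}$ such that $$\int_0^\infty\Bigl(\chi(t)-\sum_{k=1}^n c_{k,n}\,\mathbb{E}\Bigl\{\frac{Z_k}{t}\Bigr\}\Bigr)^2dt\ \xrightarrow[n\to\infty]{}\ 0 ;$$ (ii) for every real $\alpha\ge1$ with $\mathbb{E}\,Y^\alpha<\infty$ there is a constant $C$ (depending on $\alpha$ and the law of $Y$, but not on $k$) such that, for every integer $k>\alpha$, the moment $\mathbb{E}\,Z_k^\alpha$ is finite and $\mathbb{E}\,Z_k^\alpha\le C\,k^{-\alpha}$. -/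

import Mathlib

open MeasureTheory ProbabilityTheory Filter Topology

noncomputable section

/-- The indicator function `χ` of the open interval `(0,1)`. -/
def chi : ℝ → ℝ := Set.indicator (Set.Ioo 0 1) (fun _ => 1)

/-- The function `t ↦ E {Z / t}`, where `{·}` is the fractional part. -/
def meanFract {Ω : Type*} [MeasurableSpace Ω] (μ : Measure Ω) (Z : Ω → ℝ) (t : ℝ) : ℝ :=
  ∫ ω, Int.fract (Z ω / t) ∂μ

/-- `D_n² = ∫₀^∞ (χ(t) - ∑_{k=1}^n c_k E {Z_k / t})² dt`, as an element of `[0, ∞]`. -/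
def sqDist {Ω : Type*} [MeasurableSpace Ω] (μ : Measure Ω) (Z : ℕ → Ω → ℝ)
    (c : ℕ → ℝ) (n : ℕ) : ENNReal :=
  ∫⁻ t in Set.Ioi (0 : ℝ),
    ENNReal.ofReal ((chi t - ∑ k ∈ Finset.Icc 1 n, c k * meanFract μ (Z k) t) ^ 2)

/-- The sequence `(Z_k)_{k ≥ 1}` of random variables verifies gNB: there are real coefficients
`c_{k,n}` (written `c n k`, used for `1 ≤ k ≤ n` only) such that `D_n² → 0`. -/
def VerifiesGNB {Ω : Type*} [MeasurableSpace Ω] (μ : Measure Ω) (Z : ℕ → Ω → ℝ) : Prop :=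
  ∃ c : ℕ → ℕ → ℝ, Tendsto (fun n => sqDist μ Z (c n) n) atTop (𝓝 0)

end

/-! Under `t = exp v`, the map `f ↦ exp (v / 2) * f (exp v)` is an isometry from `L²(0,∞)` to
`L²(ℝ)`. Put `g u = E {Y / u}`; then `0 ≤ g u ≤ min 1 (E Y / u)` for `u > 0`, and `g > 0` near
infinity. Conditioning on `X_k` turns `E {Z_k / t}`, `k = n + 2`, into `gammaDilate g n / Γ(k)`, so
(i) follows once these functions span a dense subspace.

Let `a ∈ L²` be orthogonal to all of them. By Fubini, every moment on `(0,∞)` of `W x = x e^{-x} ∫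
a(v) e^{v/2} g(x e^v) dv` vanishes. The factor `e^{-x}` gives `W` exponential moments, so `W = 0`
a.e. (`ae_eq_zero_of_moments`). With `x = e^y` this says that `a` is orthogonal to almost every
translate of `b v = e^{v/2} g(e^v)`. Since `b` is nonnegative, nonzero and exponentially decaying,
`𝓕 b` is real analytic with `𝓕 b 0 > 0`, hence nonzero a.e.; Plancherel then forces `a = 0`
(`ae_eq_zero_of_forall_translate`).

For (ii), independence gives `E Z_k^α = Γ(k - α) / Γ(k) * E Y^α`, and log-convexity of `Γ` bounds
the quotient by `(k - α)^(-α)`, which is of order `k^(-α)`. -/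

/-! ### Orthogonality to translates, via Plancherel. -/

section Fourier

open scoped FourierTransform ContDiff ComplexInnerProductSpace

/-- Translating the frequency variable: `∫ 𝓕κ(y) b(v + y) dy = 𝓕⁻(κ · 𝓕b)(v)`. -/
theorem integral_fourier_mul_translate {κ b : ℝ → ℂ} (hκ : Integrable κ) (hb : Integrable b)
    (v : ℝ) : ∫ y, 𝓕 κ y * b (v + y) = 𝓕⁻ (fun ξ => κ ξ * 𝓕 b ξ) v := by
  -- Modulating `κ` translates its Fourier transform, so the claim reduces to the self-adjointness
  -- of `𝓕` on `L¹`.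
  set κ' : ℝ → ℂ := fun ξ => Complex.exp (↑(2 * Real.pi * ξ * v) * Complex.I) * κ ξ with hκ'
  have hκ'i : Integrable κ' := by
    refine hκ.bdd_mul (c := 1) (by fun_prop) (ae_of_all _ fun ξ => ?_)
    rw [Complex.norm_exp_ofReal_mul_I]
  have hshift : ∀ u, 𝓕 κ' u = 𝓕 κ (u - v) := by
    intro u
    rw [Real.fourier_real_eq_integral_exp_smul, Real.fourier_real_eq_integral_exp_smul]
    congr 1
    ext ξ
    simp only [hκ', smul_eq_mul]
    rw [← mul_assoc, ← Complex.exp_add]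
    congr 2
    push_cast
    ring
  have hflip := VectorFourier.integral_fourierIntegral_smul_eq_flip (L := innerₗ ℝ)
    Real.continuous_fourierChar continuous_inner hκ'i hb
  have h1 : ∫ y, 𝓕 κ y * b (v + y) = ∫ u, 𝓕 κ' u * b u := by
    rw [← integral_add_left_eq_self (fun u => 𝓕 κ' u * b u) v]
    congr 1
    ext y
    rw [hshift, add_sub_cancel_left]
  have h2 : ∫ u, 𝓕 κ' u * b u = ∫ ξ, κ' ξ * 𝓕 b ξ := by
    simpa [Real.fourier_eq, VectorFourier.fourierIntegral, real_inner_comm] using hflip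
  rw [h1, h2, Real.fourierInv_eq']
  congr 1
  ext ξ
  simp only [hκ', smul_eq_mul, mul_assoc, real_inner_comm]
  congr 3

/-- Supplies Fubini although `a` is only in `L²`: from `|a| ≤ 1 + |a|²` and `|b| ≤ K` one gets `|a
b| ≤ K |a|² + |b|`, and both terms are integrable against `φ`. -/
theorem integrable_correlation_integrand {a φ b : ℝ → ℂ} {K : ℝ}
    (ha : MemLp a 2) (hφ : Integrable φ) (hb : Integrable b) (hbK : ∀ v, ‖b v‖ ≤ K) :
    Integrable (fun p : ℝ × ℝ => φ p.1 * (a p.2 * b (p.1 + p.2))) (volume.prod volume) := by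
  have hK : 0 ≤ K := (norm_nonneg _).trans (hbK 0)
  have ha2 : Integrable (fun v => ‖a v‖ ^ 2) := ha.integrable_norm_pow (by norm_num)
  have hmp := measurePreserving_prod_add (volume : Measure ℝ) (volume : Measure ℝ)
  have h1 : Integrable (fun p : ℝ × ℝ => ‖φ p.1‖ * ‖a p.2‖ ^ 2) (volume.prod volume) :=
    hφ.norm.mul_prod ha2
  have h2 : Integrable (fun p : ℝ × ℝ => ‖φ p.1‖ * ‖b (p.1 + p.2)‖) (volume.prod volume) := by
    have := hmp.integrable_comp_of_integrable (hφ.norm.mul_prod hb.norm)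
    exact this
  have hbm : AEStronglyMeasurable (fun p : ℝ × ℝ => b (p.1 + p.2)) (volume.prod volume) := by
    have := (hb.aestronglyMeasurable.comp_snd (μ := (volume : Measure ℝ))).comp_measurePreserving hmp
    exact this
  refine ((h1.const_mul K).add h2).mono'
    (hφ.aestronglyMeasurable.comp_fst.mul (ha.aestronglyMeasurable.comp_snd.mul hbm))
    (ae_of_all _ fun p => ?_)
  simp only [norm_mul, Pi.add_apply]
  have h3 : ‖a p.2‖ * ‖b (p.1 + p.2)‖ ≤ K * ‖a p.2‖ ^ 2 + ‖b (p.1 + p.2)‖ := by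
    have h4 := hbK (p.1 + p.2)
    have h5 := norm_nonneg (b (p.1 + p.2))
    nlinarith [sq_nonneg (‖a p.2‖ - 1), sq_nonneg (‖a p.2‖),
      mul_nonneg h5 (sq_nonneg (‖a p.2‖ - 1)), mul_le_mul_of_nonneg_right h4 (sq_nonneg ‖a p.2‖),
      mul_nonneg h5 (sq_nonneg ‖a p.2‖)]
  calc ‖φ p.1‖ * (‖a p.2‖ * ‖b (p.1 + p.2)‖)
      ≤ ‖φ p.1‖ * (K * ‖a p.2‖ ^ 2 + ‖b (p.1 + p.2)‖) := by gcongr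
    _ = _ := by ring

/-- If `a ∈ L²` is orthogonal to almost every translate of `b`, and `𝓕 b` is smooth and almost
everywhere nonzero, then `a = 0`. -/
theorem ae_eq_zero_of_forall_translate {a b : ℝ → ℂ} {K : ℝ}
    (ha : MemLp a 2) (hb : Integrable b) (hbK : ∀ v, ‖b v‖ ≤ K)
    (hsm : ContDiff ℝ ∞ (𝓕 b)) (hne : ∀ᵐ ξ, 𝓕 b ξ ≠ 0)
    (h : ∀ᵐ y, ∫ v, a v * b (y + v) = 0) : a =ᵐ[volume] 0 := by
  -- The conjugate of `a`, so that the bilinear pairing `∫ a f` becomes the inner product `⟪A, f⟫`.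
  set A : Lp ℂ 2 (volume : Measure ℝ) := (MemLp.toLp _ ha.star) with hA
  have hAa : A =ᵐ[volume] star a := MemLp.coeFn_toLp _
  -- Averaging the hypothesis over `y` against `𝓕 κ` pairs `a` with `𝓕⁻ (κ · 𝓕 b)`. The cutoff `κ`
  -- makes `κ · 𝓕 b` a Schwartz function, so Plancherel moves the pairing to the frequency side.
  have key : ∀ κ : ℝ → ℝ, ContDiff ℝ ∞ κ → HasCompactSupport κ →
      ∫ ξ, κ ξ • (star ((𝓕 A : Lp ℂ 2 (volume : Measure ℝ)) ξ) * 𝓕 b ξ) = 0 := by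
    intro κ hκ hκc
    set κc : ℝ → ℂ := fun ξ => (κ ξ : ℂ) with hκcdef
    have hκcs : HasCompactSupport κc := hκc.comp_left (g := fun x : ℝ => (x : ℂ)) (by simp)
    have hκcd : ContDiff ℝ ∞ κc := Complex.ofRealCLM.contDiff.comp hκ
    set κS := hκcs.toSchwartzMap hκcd with hκS
    have hTs : HasCompactSupport (fun ξ => κc ξ * 𝓕 b ξ) := hκcs.mul_right
    set T := hTs.toSchwartzMap (hκcd.mul hsm) with hT
    have hφ : Integrable (𝓕 κc) := by
      have := (𝓕 κS).integrable (μ := volume)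
      rwa [SchwartzMap.fourier_coe] at this
    have hint := integrable_correlation_integrand ha hφ hb hbK
    have hzero : ∫ v, a v * (𝓕⁻ T) v = 0 := by
      have e1 : ∀ v, a v * (𝓕⁻ T) v = ∫ y, 𝓕 κc y * (a v * b (y + v)) := by
        intro v
        rw [SchwartzMap.fourierInv_coe]
        have := integral_fourier_mul_translate (κ := κc) (b := b) κS.integrable hb v
        change a v * 𝓕⁻ (fun ξ => κc ξ * 𝓕 b ξ) v = _
        rw [← this, ← integral_const_mul]
        congr 1
        ext y
        rw [add_comm v y]
        ring
      simp_rw [e1]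
      rw [integral_integral_swap (f := fun v y => 𝓕 κc y * (a v * b (y + v))) hint.swap]
      refine integral_eq_zero_of_ae ?_
      filter_upwards [h] with y hy
      rw [integral_const_mul, hy, mul_zero, Pi.zero_apply]
    have e2 : ⟪A, (𝓕⁻ T).toLp 2⟫ = 0 := by
      rw [L2.inner_def, ← hzero]
      refine integral_congr_ae ?_
      filter_upwards [hAa, (𝓕⁻ T).coeFn_toLp 2 volume] with v h1 h2
      rw [h1, h2]
      simp [mul_comm]
    rw [← SchwartzMap.toLp_fourierInv_eq, ← Lp.inner_fourier_eq, FourierTransform.fourier_fourierInv_eq,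
      L2.inner_def] at e2
    rw [← e2]
    refine integral_congr_ae ?_
    filter_upwards [T.coeFn_toLp 2 volume] with ξ h1
    rw [h1]
    change _ = inner ℂ _ (κc ξ * 𝓕 b ξ)
    simp [κc]
    ring
  have hloc : LocallyIntegrable
      (fun ξ => star ((𝓕 A : Lp ℂ 2 (volume : Measure ℝ)) ξ) * 𝓕 b ξ) := by
    have h1 : LocallyIntegrable (fun ξ => star ((𝓕 A : Lp ℂ 2 (volume : Measure ℝ)) ξ)) :=
      (Lp.memLp (𝓕 A)).star.locallyIntegrable (by norm_num)
    rw [← locallyIntegrableOn_univ] at h1 ⊢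
    exact h1.mul_continuousOn hsm.continuous.continuousOn isOpen_univ.isLocallyClosed
  have hz := ae_eq_zero_of_integral_contDiff_smul_eq_zero hloc key
  have hFA : (𝓕 A : Lp ℂ 2 (volume : Measure ℝ)) = 0 := by
    rw [Lp.eq_zero_iff_ae_eq_zero]
    filter_upwards [hz, hne] with ξ h1 h2
    simpa [h2] using h1
  have hA0 : A = 0 := by
    rw [← norm_eq_zero, ← Lp.norm_fourier_eq, hFA, norm_zero]
  rw [Lp.eq_zero_iff_ae_eq_zero] at hA0
  filter_upwards [hA0, hAa] with v h1 h2
  rw [h1] at h2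
  simpa using h2.symm

end Fourier

/-! ### Moment determinacy. -/

section Moments

/-- Moment determinacy: finite measures on `ℝ` with exponential moments near `0` are determined by
their moments. -/
theorem measure_ext_of_moments {μ ν : Measure ℝ} [IsFiniteMeasure μ] [IsFiniteMeasure ν]
    (hμ : 0 ∈ interior (integrableExpSet id μ)) (hν : 0 ∈ interior (integrableExpSet id ν))
    (h : ∀ n : ℕ, ∫ x, x ^ n ∂μ = ∫ x, x ^ n ∂ν) : μ = ν := by
  -- Equal moments mean equal Taylor series at `0`. The identity theorem on a vertical strip then
  -- carries the equality of the transforms to the imaginary axis, where they are the characteristic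
  -- functions.
  have hev : ∀ᶠ t in 𝓝 (0 : ℝ), mgf id μ t = mgf id ν t := by
    have h1 := (hasFPowerSeriesAt_mgf hμ).eventually_hasSum
    have h2 := (hasFPowerSeriesAt_mgf hν).eventually_hasSum
    filter_upwards [h1, h2] with t ht1 ht2
    simp only [id, zero_mul, Real.exp_zero, mul_one, zero_add, h] at ht1 ht2
    exact ht1.unique ht2
  set S := interior (integrableExpSet id μ) ∩ interior (integrableExpSet id ν) with hS
  set U : Set ℂ := {z | z.re ∈ S} with hU
  have hUc : IsPreconnected U :=
    ((convex_integrableExpSet.interior.inter convex_integrableExpSet.interior).linear_preimage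
      Complex.reLm).isPreconnected
  have hfreq : ∃ᶠ z in 𝓝[≠] (0 : ℂ), complexMGF id μ z = complexMGF id ν z := by
    have h3 : Tendsto (fun x : ℝ => (x : ℂ)) (𝓝[≠] 0) (𝓝[≠] 0) := by
      refine tendsto_nhdsWithin_iff.2 ⟨?_, ?_⟩
      · exact (Complex.continuous_ofReal.tendsto' 0 0 (by simp)).mono_left nhdsWithin_le_nhds
      · filter_upwards [self_mem_nhdsWithin] with x hx
        simpa using hx
    refine h3.frequently (Eventually.frequently ?_)
    filter_upwards [nhdsWithin_le_nhds hev] with t ht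
    rw [complexMGF_ofReal, complexMGF_ofReal, ht]
  have heq : Set.EqOn (complexMGF id μ) (complexMGF id ν) U :=
    AnalyticOnNhd.eqOn_of_preconnected_of_frequently_eq
      (analyticOnNhd_complexMGF.mono fun z hz => hz.1)
      (analyticOnNhd_complexMGF.mono fun z hz => hz.2) hUc (z₀ := 0)
      (by simpa [hU, hS] using And.intro hμ hν) hfreq
  refine Measure.ext_of_charFun ?_
  ext t
  rw [← complexMGF_id_mul_I, ← complexMGF_id_mul_I]
  exact heq (by simpa [hU, hS] using And.intro hμ hν)

/-- A function with exponential moments near `0` all of whose moments vanish is zero. -/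
theorem ae_eq_zero_of_moments {m : Measure ℝ} {W : ℝ → ℝ} (hW : Measurable W) {c : ℝ} (hc : 0 < c)
    (hint : ∀ t, |t| < c → Integrable (fun x => Real.exp (t * x) * W x) m)
    (h : ∀ n : ℕ, ∫ x, x ^ n * W x ∂m = 0) : W =ᵐ[m] 0 := by
  have hW0 : Integrable W m := by simpa using hint 0 (by simpa using hc)
  -- Applied to `W` and `-W`: the densities `W⁺` and `W⁻` define finite measures with the same
  -- moments, hence equal.
  have main : ∀ V : ℝ → ℝ, Measurable V → Integrable V m →
      (∀ t, |t| < c → Integrable (fun x => Real.exp (t * x) * V x) m) →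
      IsFiniteMeasure (m.withDensity fun x => ENNReal.ofReal (V x)) ∧
      0 ∈ interior (integrableExpSet id (m.withDensity fun x => ENNReal.ofReal (V x))) ∧
      ∀ n : ℕ, Integrable (fun x => x ^ n * max (V x) 0) m ∧
        ∫ x, x ^ n ∂(m.withDensity fun x => ENNReal.ofReal (V x)) = ∫ x, x ^ n * max (V x) 0 ∂m := by
    intro V hV hV0 hVt
    have hmeas : Measurable fun x => ENNReal.ofReal (V x) := hV.ennreal_ofReal
    have hlt : ∀ᵐ x ∂m, ENNReal.ofReal (V x) < ⊤ := ae_of_all _ fun _ => ENNReal.ofReal_lt_top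
    have hint0 : 0 ∈ interior (integrableExpSet id
        (m.withDensity fun x => ENNReal.ofReal (V x))) := by
      refine mem_interior_iff_mem_nhds.2 ?_
      filter_upwards [Metric.ball_mem_nhds (0 : ℝ) hc] with t ht
      have ht' : |t| < c := by simpa using ht
      change Integrable _ _
      rw [integrable_withDensity_iff_integrable_smul' hmeas hlt]
      refine (hVt t ht').mono (by fun_prop) (ae_of_all _ fun x => ?_)
      simp only [ENNReal.toReal_ofReal', smul_eq_mul, norm_mul, id, Real.norm_eq_abs]
      rw [mul_comm]
      refine mul_le_mul_of_nonneg_left ?_ (abs_nonneg _)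
      rw [abs_of_nonneg (le_max_right _ _)]
      exact max_le (le_abs_self _) (abs_nonneg _)
    refine ⟨isFiniteMeasure_withDensity_ofReal hV0.2, hint0, fun n => ⟨?_, ?_⟩⟩
    · have := integrable_pow_of_mem_interior_integrableExpSet hint0 n
      rw [integrable_withDensity_iff_integrable_smul' hmeas hlt] at this
      simpa [ENNReal.toReal_ofReal', mul_comm] using this
    · rw [integral_withDensity_eq_integral_toReal_smul hmeas hlt]
      simp [ENNReal.toReal_ofReal', mul_comm]
  obtain ⟨f1, i1, m1⟩ := main W hW hW0 hint
  obtain ⟨f2, i2, m2⟩ := main (-W) hW.neg hW0.neg (fun t ht => by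
    simpa using (hint t ht).neg)
  have heq := measure_ext_of_moments i1 i2 (fun n => by
    rw [(m1 n).2, (m2 n).2, ← sub_eq_zero, ← integral_sub (m1 n).1 (m2 n).1]
    refine Eq.trans ?_ (h n)
    congr 1
    ext x
    rw [← mul_sub, Pi.neg_apply, max_zero_sub_max_neg_zero_eq_self])
  rw [withDensity_eq_iff hW.ennreal_ofReal.aemeasurable hW.neg.ennreal_ofReal.aemeasurable
    (by simpa [hasFiniteIntegral_iff_ofReal] using hW0.lintegral_lt_top.ne)] at heq
  filter_upwards [heq] with x hx
  have h1 := congrArg ENNReal.toReal hx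
  rw [ENNReal.toReal_ofReal', ENNReal.toReal_ofReal', Pi.neg_apply] at h1
  rw [← max_zero_sub_max_neg_zero_eq_self (W x), h1, sub_self, Pi.zero_apply]

end Moments

/-! ### Logarithmic coordinates and completeness of the Gamma dilates. -/

section Kernel

open scoped FourierTransform ContDiff

theorem integrable_exp_neg_mul_abs {c : ℝ} (hc : 0 < c) :
    Integrable (fun v : ℝ => Real.exp (-(c * |v|))) := by
  have h1 : IntegrableOn (fun v : ℝ => Real.exp (-(c * |v|))) (Set.Iic 0) := by
    refine (integrableOn_exp_mul_Iic hc 0).congr_fun (fun v hv => ?_) measurableSet_Iic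
    rw [abs_of_nonpos hv]
    ring_nf
  have h2 : IntegrableOn (fun v : ℝ => Real.exp (-(c * |v|))) (Set.Ioi 0) := by
    refine (integrableOn_exp_mul_Ioi (neg_lt_zero.2 hc) 0).congr_fun (fun v hv => ?_)
      measurableSet_Ioi
    rw [abs_of_pos hv]
    ring_nf
  rw [← integrableOn_univ, ← Set.Iic_union_Ioi (a := (0 : ℝ))]
  exact h1.union h2

theorem memLp_two_of_le_exp_neg_abs {f : ℝ → ℝ} {C c : ℝ} (hc : 0 < c)
    (hf : AEStronglyMeasurable f) (h : ∀ v, |f v| ≤ C * Real.exp (-(c * |v|))) : MemLp f 2 := by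
  rw [memLp_two_iff_integrable_sq hf]
  refine ((integrable_exp_neg_mul_abs (c := 2 * c) (by positivity)).const_mul (C ^ 2)).mono'
    (hf.pow 2) (ae_of_all _ fun v => ?_)
  rw [Real.norm_eq_abs, abs_pow]
  calc |f v| ^ 2 ≤ (C * Real.exp (-(c * |v|))) ^ 2 := by gcongr; exact h v
    _ = _ := by
      rw [mul_pow, ← Real.exp_nat_mul]
      push_cast
      ring_nf

/-- The Fourier transform of a nonnegative, nonzero, exponentially decaying function is smooth and
vanishes only on a null set. -/
theorem contDiff_fourier_and_ae_ne_zero {b : ℝ → ℝ} {K c : ℝ} (hc : 0 < c) (hb : Measurable b)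
    (hb0 : ∀ v, 0 ≤ b v) (hbK : ∀ v, b v ≤ K * Real.exp (-(c * |v|))) (hpos : 0 < ∫ v, b v) :
    ContDiff ℝ ∞ (𝓕 fun v => (b v : ℂ)) ∧ ∀ᵐ ξ, (𝓕 fun v => (b v : ℂ)) ξ ≠ 0 := by
  set ν := (volume : Measure ℝ).withDensity fun v => ENNReal.ofReal (b v) with hν
  have hmeas : Measurable fun x => ENNReal.ofReal (b x) := hb.ennreal_ofReal
  have hlt : ∀ᵐ x : ℝ, ENNReal.ofReal (b x) < ⊤ := ae_of_all _ fun _ => ENNReal.ofReal_lt_top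
  have hint0 : 0 ∈ interior (integrableExpSet id ν) := by
    refine mem_interior_iff_mem_nhds.2 ?_
    filter_upwards [Metric.ball_mem_nhds (0 : ℝ) (half_pos hc)] with t ht
    have ht' : |t| < c / 2 := by simpa using ht
    change Integrable _ _
    rw [integrable_withDensity_iff_integrable_smul' hmeas hlt]
    refine ((integrable_exp_neg_mul_abs (half_pos hc)).const_mul K).mono' (by fun_prop)
      (ae_of_all _ fun v => ?_)
    rw [ENNReal.toReal_ofReal (hb0 v), smul_eq_mul, Real.norm_eq_abs,
      abs_of_nonneg (mul_nonneg (hb0 v) (Real.exp_pos _).le), id]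
    have htv : t * v ≤ c / 2 * |v| := by
      calc t * v ≤ |t| * |v| := by rw [← abs_mul]; exact le_abs_self _
        _ ≤ _ := by gcongr
    calc b v * Real.exp (t * v) ≤ K * Real.exp (-(c * |v|)) * Real.exp (c / 2 * |v|) := by
          exact mul_le_mul (hbK v) (Real.exp_le_exp.2 htv) (Real.exp_pos _).le
            ((hb0 v).trans (hbK v))
      _ = _ := by
        rw [mul_assoc, ← Real.exp_add]
        ring_nf
  constructor
  · refine Real.contDiff_fourier (N := ⊤) fun n _ => ?_
    have := integrable_pow_abs_of_mem_interior_integrableExpSet hint0 n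
    rw [integrable_withDensity_iff_integrable_smul' hmeas hlt] at this
    refine this.congr (ae_of_all _ fun v => ?_)
    simp [ENNReal.toReal_ofReal (hb0 v), abs_of_nonneg (hb0 v), mul_comm]
  -- `𝓕 b` is the complex moment generating function along the imaginary axis, hence real analytic;
  -- as `F 0 = ∫ b > 0`, its zeros are isolated and form a null set.
  · set F : ℝ → ℂ := fun ξ => complexMGF id ν (-(2 * Real.pi * Complex.I) * ξ) with hF
    have hFeq : ∀ ξ, (𝓕 fun v => (b v : ℂ)) ξ = F ξ := by
      intro ξ
      rw [Real.fourier_real_eq_integral_exp_smul, hF]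
      simp only [complexMGF, id]
      rw [integral_withDensity_eq_integral_toReal_smul hmeas hlt]
      congr 1
      ext v
      rw [ENNReal.toReal_ofReal (hb0 v), Complex.real_smul, smul_eq_mul, mul_comm]
      congr 2
      push_cast
      ring
    have hFan : AnalyticOnNhd ℝ F Set.univ := by
      intro ξ _
      have h1 : AnalyticAt ℂ (complexMGF id ν) (-(2 * Real.pi * Complex.I) * ξ) :=
        analyticAt_complexMGF (by simpa using hint0)
      have h2 : AnalyticAt ℝ (fun ξ : ℝ => -(2 * Real.pi * Complex.I) * (ξ : ℂ)) ξ :=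
        analyticAt_const.mul (Complex.ofRealCLM.analyticAt ξ)
      exact AnalyticAt.comp (f := fun ξ : ℝ => -(2 * Real.pi * Complex.I) * (ξ : ℂ))
        h1.restrictScalars h2
    have hF0 : F 0 ≠ 0 := by
      rw [← hFeq, Real.fourier_real_eq_integral_exp_smul]
      simp only [mul_zero, Complex.ofReal_zero, zero_mul, Complex.exp_zero, one_smul]
      rw [integral_complex_ofReal]
      exact_mod_cast hpos.ne'
    have h3 := hFan.preimage_zero_mem_codiscreteWithin hF0 (Set.mem_univ _) isConnected_univ
    have h4 := ae_restrict_le_codiscreteWithin (μ := volume) MeasurableSet.univ h3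
    rw [Measure.restrict_univ] at h4
    filter_upwards [h4] with ξ hξ
    rw [hFeq]
    exact hξ

theorem lintegral_Ioi_eq_lintegral_exp (G : ℝ → ENNReal) :
    ∫⁻ t in Set.Ioi 0, G t = ∫⁻ v, ENNReal.ofReal (Real.exp v) * G (Real.exp v) := by
  have := lintegral_image_eq_lintegral_abs_deriv_mul MeasurableSet.univ
    (fun x _ => (Real.hasDerivAt_exp x).hasDerivWithinAt) Real.exp_injective.injOn G
  simpa [Set.image_univ, Real.range_exp] using this

theorem ae_exp_of_ae_Ioi {P : ℝ → Prop} (h : ∀ᵐ x ∂volume.restrict (Set.Ioi 0), P x) :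
    ∀ᵐ y, P (Real.exp y) := by
  obtain ⟨N, hN, hNm, hN0⟩ := exists_measurable_superset_of_null (ae_iff.1 h)
  have h1 := lintegral_Ioi_eq_lintegral_exp (N.indicator 1)
  have hmeas : Measurable fun v => ENNReal.ofReal (Real.exp v) * N.indicator 1 (Real.exp v) :=
    Real.measurable_exp.ennreal_ofReal.mul
      ((measurable_one.indicator hNm).comp Real.measurable_exp)
  rw [lintegral_indicator_one hNm, hN0, eq_comm, lintegral_eq_zero_iff hmeas] at h1
  filter_upwards [h1] with y hy
  by_contra hP
  have : Real.exp y ∈ N := hN hP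
  simp [this, Real.exp_pos, not_le.2] at hy

/-- `∫₀^∞ x^{n+1} e^{-x} e^{v/2} g(x e^v) dx`: up to the factor `Γ(n+2)`, this is the average of
`g` dilated by a `Γ(n+2,1)` variable, in logarithmic coordinates. -/
noncomputable def gammaDilate (g : ℝ → ℝ) (n : ℕ) (v : ℝ) : ℝ :=
  ∫ x in Set.Ioi (0 : ℝ), x ^ n * (x * Real.exp (-x) * (Real.exp (v / 2) * g (x * Real.exp v)))

variable {g : ℝ → ℝ} {M : ℝ}

/-- For `v ≥ 0` use `g u ≤ M / u`, for `v ≤ 0` use `g ≤ 1`. The factor `x` cancels the `1 / x` of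
the first bound; this is why the Gamma shapes start at `2`. -/
theorem mul_exp_half_mul_le (hg1 : ∀ u, g u ≤ 1) (hM : 0 ≤ M)
    (hgM : ∀ u, 0 < u → g u ≤ M / u) {x : ℝ} (hx : 0 < x) (v : ℝ) :
    x * (Real.exp (v / 2) * g (x * Real.exp v)) ≤
      (1 + x) * ((1 + M) * Real.exp (-(1 / 2 * |v|))) := by
  rcases le_total 0 v with hv | hv
  · have h1 := hgM (x * Real.exp v) (by positivity)
    have h2 : Real.exp v = Real.exp (v / 2) * Real.exp (v / 2) := by
      rw [← Real.exp_add]; ring_nf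
    have h3 : Real.exp (-(1 / 2 * |v|)) = (Real.exp (v / 2))⁻¹ := by
      rw [abs_of_nonneg hv, ← Real.exp_neg]; ring_nf
    calc x * (Real.exp (v / 2) * g (x * Real.exp v))
        ≤ x * (Real.exp (v / 2) * (M / (x * Real.exp v))) := by gcongr
      _ = M * (Real.exp (v / 2))⁻¹ := by
        rw [h2]; field_simp
      _ ≤ (1 + x) * ((1 + M) * Real.exp (-(1 / 2 * |v|))) := by
        rw [h3, ← mul_assoc]
        gcongr
        nlinarith
  · have h3 : Real.exp (-(1 / 2 * |v|)) = Real.exp (v / 2) := by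
      rw [abs_of_nonpos hv]; ring_nf
    calc x * (Real.exp (v / 2) * g (x * Real.exp v))
        ≤ x * (Real.exp (v / 2) * 1) := by gcongr; exact hg1 _
      _ = x * Real.exp (v / 2) := by ring
      _ ≤ (1 + x) * ((1 + M) * Real.exp (-(1 / 2 * |v|))) := by
        rw [h3, ← mul_assoc]
        gcongr
        nlinarith

theorem integrableOn_pow_mul_exp_neg (n : ℕ) :
    IntegrableOn (fun x : ℝ => x ^ n * ((1 + x) * Real.exp (-x))) (Set.Ioi 0) := by
  have h (m : ℕ) : IntegrableOn (fun x : ℝ => x ^ m * Real.exp (-x)) (Set.Ioi 0) := by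
    have := Real.GammaIntegral_convergent (s := m + 1) (by positivity)
    refine this.congr_fun (fun x _ => ?_) measurableSet_Ioi
    simp [mul_comm]
  refine ((h n).add (h (n + 1))).congr_fun (fun x _ => ?_) measurableSet_Ioi
  simp only [Pi.add_apply]
  ring

theorem norm_gammaDilate_integrand_le (hg0 : ∀ u, 0 ≤ g u) (hg1 : ∀ u, g u ≤ 1) (hM : 0 ≤ M)
    (hgM : ∀ u, 0 < u → g u ≤ M / u) (n : ℕ) {x : ℝ} (hx : 0 < x) (v : ℝ) :
    ‖x ^ n * (x * Real.exp (-x) * (Real.exp (v / 2) * g (x * Real.exp v)))‖ ≤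
      x ^ n * ((1 + x) * Real.exp (-x)) * ((1 + M) * Real.exp (-(1 / 2 * |v|))) := by
  have h0 := hg0 (x * Real.exp v)
  rw [Real.norm_of_nonneg (by positivity)]
  calc _ = x ^ n * Real.exp (-x) * (x * (Real.exp (v / 2) * g (x * Real.exp v))) := by ring
    _ ≤ x ^ n * Real.exp (-x) * ((1 + x) * ((1 + M) * Real.exp (-(1 / 2 * |v|)))) := by
      exact mul_le_mul_of_nonneg_left (mul_exp_half_mul_le hg1 hM hgM hx v) (by positivity)
    _ = _ := by ring

theorem memLp_gammaDilate (hg : Measurable g) (hg0 : ∀ u, 0 ≤ g u) (hg1 : ∀ u, g u ≤ 1)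
    (hM : 0 ≤ M) (hgM : ∀ u, 0 < u → g u ≤ M / u) (n : ℕ) : MemLp (gammaDilate g n) 2 := by
  refine memLp_two_of_le_exp_neg_abs (c := 1 / 2)
    (C := (∫ x in Set.Ioi (0 : ℝ), x ^ n * ((1 + x) * Real.exp (-x))) * (1 + M)) (by norm_num)
    ?_ fun v => ?_
  · refine StronglyMeasurable.aestronglyMeasurable ?_
    exact StronglyMeasurable.integral_prod_right (f := fun v x =>
      x ^ n * (x * Real.exp (-x) * (Real.exp (v / 2) * g (x * Real.exp v))))
      (Measurable.stronglyMeasurable (by fun_prop))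
  · rw [mul_assoc, ← integral_mul_const, ← Real.norm_eq_abs]
    refine norm_integral_le_of_norm_le ((integrableOn_pow_mul_exp_neg n).mul_const _) ?_
    filter_upwards [ae_restrict_mem measurableSet_Ioi] with x hx
    exact norm_gammaDilate_integrand_le hg0 hg1 hM hgM n hx v

/-- Only the zero function of `L²` is orthogonal to all the functions `gammaDilate g n`. -/
theorem ae_eq_zero_of_forall_gammaDilate (hg : Measurable g) (hg0 : ∀ u, 0 ≤ g u)
    (hg1 : ∀ u, g u ≤ 1) (hM : 0 ≤ M) (hgM : ∀ u, 0 < u → g u ≤ M / u)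
    {R : ℝ} (hR : ∀ u, R ≤ u → 0 < g u) {a : ℝ → ℝ} (ham : Measurable a) (ha : MemLp a 2)
    (h : ∀ n, ∫ v, a v * gammaDilate g n v = 0) : a =ᵐ[volume] 0 := by
  set E : ℝ → ℝ := fun v => (1 + M) * Real.exp (-(1 / 2 * |v|)) with hE
  have hEm : Measurable E := by fun_prop
  have hE2 : MemLp E 2 := by
    refine memLp_two_of_le_exp_neg_abs (c := 1 / 2) (C := 1 + M) (by norm_num)
      hEm.aestronglyMeasurable fun v => ?_
    rw [abs_of_nonneg (by positivity)]
  have haE : Integrable (fun v => |a v| * E v) := ha.abs.integrable_mul hE2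
  set W : ℝ → ℝ := fun x => ∫ v, a v *
    (x * Real.exp (-x) * (Real.exp (v / 2) * g (x * Real.exp v))) with hW
  have hWm : Measurable W := StronglyMeasurable.measurable <|
    StronglyMeasurable.integral_prod_right (f := fun x v => a v *
      (x * Real.exp (-x) * (Real.exp (v / 2) * g (x * Real.exp v))))
      (Measurable.stronglyMeasurable (by fun_prop))
  have hWle : ∀ x, 0 < x → |W x| ≤ (1 + x) * Real.exp (-x) * ∫ v, |a v| * E v := by
    intro x hx
    rw [← integral_const_mul, ← Real.norm_eq_abs]
    refine norm_integral_le_of_norm_le (haE.const_mul _) (ae_of_all _ fun v => ?_)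
    have := norm_gammaDilate_integrand_le hg0 hg1 hM hgM 0 hx v
    rw [pow_zero, one_mul, one_mul] at this
    rw [norm_mul, Real.norm_eq_abs (a v)]
    calc |a v| * _ ≤ |a v| * _ := mul_le_mul_of_nonneg_left this (abs_nonneg _)
      _ = _ := by ring
  have hmom : ∀ n : ℕ, ∫ x in Set.Ioi 0, x ^ n * W x = 0 := by
    intro n
    have hprod : Integrable (fun p : ℝ × ℝ => p.1 ^ n * (a p.2 * (p.1 * Real.exp (-p.1) *
        (Real.exp (p.2 / 2) * g (p.1 * Real.exp p.2)))))
        ((volume.restrict (Set.Ioi 0)).prod volume) := by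
      refine (Integrable.mul_prod (integrableOn_pow_mul_exp_neg n) haE).mono'
        (Measurable.aestronglyMeasurable (by fun_prop)) ?_
      have : ∀ᵐ p : ℝ × ℝ ∂((volume.restrict (Set.Ioi 0)).prod volume), 0 < p.1 :=
        Measure.quasiMeasurePreserving_fst.ae (ae_restrict_mem measurableSet_Ioi)
      filter_upwards [this] with p hp
      have := norm_gammaDilate_integrand_le hg0 hg1 hM hgM n hp p.2
      rw [mul_left_comm, norm_mul, Real.norm_eq_abs (a p.2)]
      calc |a p.2| * _ ≤ |a p.2| * _ := mul_le_mul_of_nonneg_left this (abs_nonneg _)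
        _ = _ := by ring
    refine Eq.trans ?_ (h n)
    simp_rw [hW, ← integral_const_mul]
    rw [integral_integral_swap (f := fun x v => x ^ n * (a v * (x * Real.exp (-x) *
        (Real.exp (v / 2) * g (x * Real.exp v))))) hprod]
    congr 1
    ext v
    rw [gammaDilate, ← integral_const_mul]
    congr 1
    ext x
    ring
  -- With `1 + x ≤ 4 e^{x/4}` and `|t| < 1/2`, the exponents add up to `1/2 + 1/4 - 1 = -1/4`.
  have hWexp : ∀ t, |t| < 1 / 2 →
      Integrable (fun x => Real.exp (t * x) * W x) (volume.restrict (Set.Ioi 0)) := by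
    intro t ht
    refine ((integrableOn_exp_mul_Ioi (a := -(1 / 4)) (by norm_num) 0).const_mul
      (4 * ∫ v, |a v| * E v)).mono' (by fun_prop) ?_
    filter_upwards [ae_restrict_mem measurableSet_Ioi] with x hx
    have hx' : 0 < x := hx
    have hI : 0 ≤ ∫ v, |a v| * E v := integral_nonneg fun v => by positivity
    rw [norm_mul, Real.norm_eq_abs, Real.norm_eq_abs, Real.abs_exp]
    have h1 : 1 + x ≤ 4 * Real.exp (x / 4) := by
      have := Real.add_one_le_exp (x / 4)
      linarith
    calc Real.exp (t * x) * |W x|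
        ≤ Real.exp (1 / 2 * x) * (4 * Real.exp (x / 4) * Real.exp (-x) * ∫ v, |a v| * E v) := by
          gcongr
          · exact (abs_lt.1 ht).2.le
          · exact (hWle x hx').trans (by gcongr)
      _ = 4 * (∫ v, |a v| * E v) * (Real.exp (1 / 2 * x) * Real.exp (x / 4) * Real.exp (-x)) := by
          ring
      _ = _ := by
          rw [← Real.exp_add, ← Real.exp_add]
          ring_nf
  have hW0 := ae_eq_zero_of_moments hWm (by norm_num) hWexp hmom
  set b : ℝ → ℝ := fun v => Real.exp (v / 2) * g (Real.exp v) with hb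
  have hbm : Measurable b := by fun_prop
  have hb0 : ∀ v, 0 ≤ b v := fun v => mul_nonneg (Real.exp_pos _).le (hg0 _)
  have hbE : ∀ v, b v ≤ 2 * (1 + M) * Real.exp (-(1 / 2 * |v|)) := by
    intro v
    have := mul_exp_half_mul_le hg1 hM hgM one_pos v
    simp only [one_mul] at this
    linarith
  have hbi : Integrable b := by
    refine ((integrable_exp_neg_mul_abs (c := 1 / 2) (by norm_num)).const_mul (2 * (1 + M))).mono'
      hbm.aestronglyMeasurable (ae_of_all _ fun v => ?_)
    rw [Real.norm_of_nonneg (hb0 v)]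
    exact hbE v
  have hbpos : 0 < ∫ v, b v := by
    rw [integral_pos_iff_support_of_nonneg hb0 hbi]
    refine lt_of_lt_of_le ?_ (measure_mono (s := Set.Ioi R) fun v hv => ?_)
    · simp
    · have : R ≤ Real.exp v := (le_of_lt hv).trans
        (by linarith [Real.add_one_le_exp v])
      exact (mul_pos (Real.exp_pos _) (hR _ this)).ne'
  obtain ⟨hsm, hne⟩ := contDiff_fourier_and_ae_ne_zero (by norm_num) hbm hb0 hbE hbpos
  have hac : MemLp (fun v => (a v : ℂ)) 2 := ha.ofReal
  have hbc : Integrable (fun v => (b v : ℂ)) := hbi.ofReal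
  have hfin := ae_eq_zero_of_forall_translate (K := 2 * (1 + M)) hac hbc (fun v => ?_) hsm hne ?_
  · filter_upwards [hfin] with v hv
    simpa using hv
  · simp only [Complex.norm_real, Real.norm_of_nonneg (hb0 v)]
    refine (hbE v).trans (mul_le_of_le_one_right (by positivity) (Real.exp_le_one_iff.2 ?_))
    simp
  · filter_upwards [ae_exp_of_ae_Ioi hW0] with y hy
    -- At `x = e^y`, writing `e^y e^{v/2} = e^{y/2} e^{(y+v)/2}` turns the dilation into a
    -- translation.
    have h1 : W (Real.exp y) = Real.exp (y / 2) * Real.exp (-Real.exp y) *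
        ∫ v, a v * b (y + v) := by
      simp only [hW]
      rw [← integral_const_mul]
      refine integral_congr_ae (ae_of_all _ fun v => ?_)
      have h2 : Real.exp y = Real.exp (y / 2) * Real.exp (y / 2) := by
        rw [← Real.exp_add]; ring_nf
      have h3 : Real.exp ((y + v) / 2) = Real.exp (y / 2) * Real.exp (v / 2) := by
        rw [← Real.exp_add]; ring_nf
      simp only [hb]
      rw [Real.exp_add y v, h3]
      generalize g _ = G
      generalize Real.exp (-Real.exp y) = Q
      rw [h2]
      ring
    rw [h1, Pi.zero_apply, mul_eq_zero] at hy
    have h4 : ∫ v, a v * b (y + v) = 0 := hy.resolve_left (by positivity)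
    have h5 : ∫ v, (a v : ℂ) * (b (y + v) : ℂ) = ((∫ v, a v * b (y + v) : ℝ) : ℂ) := by
      rw [← integral_complex_ofReal]
      congr 1
      ext v
      push_cast
      rfl
    rw [h5, h4, Complex.ofReal_zero]

end Kernel

/-! ### Gamma laws and Gamma function estimates. -/

section Gamma

variable {a : ℝ}

theorem gammaMeasure_one_eq (a : ℝ) : gammaMeasure a 1 = (volume.restrict (Set.Ioi 0)).withDensity
    fun x => ENNReal.ofReal (x ^ (a - 1) * Real.exp (-x) / Real.Gamma a) := by
  rw [← withDensity_indicator measurableSet_Ioi, gammaMeasure]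
  refine withDensity_congr_ae ?_
  filter_upwards [compl_mem_ae_iff.2 (measure_singleton (0 : ℝ))] with x hx
  have hx0 : x ≠ 0 := hx
  rcases lt_or_gt_of_ne hx0 with h | h
  · rw [gammaPDF_of_neg h, Set.indicator_of_notMem (by simpa using h.le)]
  · rw [gammaPDF_of_nonneg h.le, Set.indicator_of_mem (by simpa using h)]
    congr 1
    rw [Real.one_rpow, one_mul]
    ring

theorem ae_gammaMeasure_pos (a : ℝ) : ∀ᵐ x ∂gammaMeasure a 1, 0 < x := by
  rw [gammaMeasure_one_eq]
  exact (withDensity_absolutelyContinuous _ _).ae_le (ae_restrict_mem measurableSet_Ioi)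

theorem toReal_gamma_density (ha : 0 < a) {x : ℝ} (hx : 0 < x) :
    (ENNReal.ofReal (x ^ (a - 1) * Real.exp (-x) / Real.Gamma a)).toReal =
      x ^ (a - 1) * Real.exp (-x) / Real.Gamma a :=
  ENNReal.toReal_ofReal (by have := Real.Gamma_pos_of_pos ha; positivity)

theorem integral_gammaMeasure (ha : 0 < a) (f : ℝ → ℝ) : ∫ x, f x ∂gammaMeasure a 1 =
    ∫ x in Set.Ioi 0, x ^ (a - 1) * Real.exp (-x) / Real.Gamma a * f x := by
  rw [gammaMeasure_one_eq, integral_withDensity_eq_integral_toReal_smul (by fun_prop)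
    (ae_of_all _ fun _ => ENNReal.ofReal_lt_top)]
  refine setIntegral_congr_fun measurableSet_Ioi fun x hx => ?_
  simp only [toReal_gamma_density ha hx, smul_eq_mul]

theorem integrable_gammaMeasure_iff (ha : 0 < a) (f : ℝ → ℝ) : Integrable f (gammaMeasure a 1) ↔
    IntegrableOn (fun x => x ^ (a - 1) * Real.exp (-x) / Real.Gamma a * f x) (Set.Ioi 0) := by
  rw [gammaMeasure_one_eq, integrable_withDensity_iff_integrable_smul' (by fun_prop)
    (ae_of_all _ fun _ => ENNReal.ofReal_lt_top)]
  refine integrableOn_congr_fun (fun x hx => ?_) measurableSet_Ioi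
  simp only [toReal_gamma_density ha hx, smul_eq_mul]

/-- Negative moments of the Gamma distribution. -/
theorem gammaMeasure_rpow_neg {α : ℝ} (ha : 0 < a) (hα : α < a) :
    Integrable (fun x => x ^ (-α)) (gammaMeasure a 1) ∧
      ∫ x, x ^ (-α) ∂gammaMeasure a 1 = Real.Gamma (a - α) / Real.Gamma a := by
  have h : ∀ x ∈ Set.Ioi (0 : ℝ), x ^ (a - 1) * Real.exp (-x) / Real.Gamma a * x ^ (-α) =
      (Real.Gamma a)⁻¹ * (Real.exp (-x) * x ^ (a - α - 1)) := by
    intro x hx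
    have : x ^ (a - α - 1) = x ^ (a - 1) * x ^ (-α) := by
      rw [← Real.rpow_add hx]
      ring_nf
    rw [this]
    ring
  have hpos : 0 < a - α := sub_pos.2 hα
  constructor
  · rw [integrable_gammaMeasure_iff ha, integrableOn_congr_fun h measurableSet_Ioi]
    exact (Real.GammaIntegral_convergent hpos).const_mul _
  · rw [integral_gammaMeasure ha, setIntegral_congr_fun measurableSet_Ioi h, integral_const_mul,
      ← Real.Gamma_eq_integral hpos]
    ring

/-- Log-convexity bound `Γ(x) x^α ≤ Γ(x + α)` for `α ≥ 1`. -/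
theorem Gamma_mul_rpow_le {x α : ℝ} (hx : 0 < x) (hα : 1 ≤ α) :
    Real.Gamma x * x ^ α ≤ Real.Gamma (x + α) := by
  have h0 := Real.Gamma_pos_of_pos hx
  have h1 : 0 < Real.Gamma (x + α) := Real.Gamma_pos_of_pos (by positivity)
  have hα0 : 0 < α := one_pos.trans_le hα
  have hα1 : 0 ≤ 1 - 1 / α := by rw [sub_nonneg, div_le_one hα0]; exact hα
  have hα2 : 0 ≤ 1 / α := by positivity
  have hconv := Real.convexOn_log_Gamma.2 (Set.mem_Ioi.2 hx)
    (Set.mem_Ioi.2 (show 0 < x + α by positivity)) hα1 hα2 (sub_add_cancel _ _)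
  -- These weights place `x + 1` between `x` and `x + α`, where `Γ(x + 1) = x Γ(x)` produces the
  -- power of `x`.
  have he : (1 - 1 / α) • x + (1 / α) • (x + α) = x + 1 := by
    simp only [smul_eq_mul]
    field_simp
    ring
  rw [he] at hconv
  simp only [Function.comp_apply, smul_eq_mul, Real.Gamma_add_one hx.ne',
    Real.log_mul hx.ne' h0.ne'] at hconv
  have h2 : Real.log (Real.Gamma x * x ^ α) ≤ Real.log (Real.Gamma (x + α)) := by
    rw [Real.log_mul h0.ne' (by positivity), Real.log_rpow hx]
    have h3 := mul_le_mul_of_nonneg_left hconv hα0.le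
    have h4 : α * ((1 - 1 / α) * Real.log (Real.Gamma x) +
        1 / α * Real.log (Real.Gamma (x + α))) =
        (α - 1) * Real.log (Real.Gamma x) + Real.log (Real.Gamma (x + α)) := by
      field_simp
    rw [h4] at h3
    linarith
  exact (Real.log_le_log_iff (by positivity) h1).1 h2

end Gamma

/-! ### The mean fractional part of `Y` and its Gamma averages. -/

section MeanFract

variable {Ω : Type*} [MeasurableSpace Ω] {μ : Measure Ω} {Y : Ω → ℝ}

theorem meanFract_nonneg (u : ℝ) : 0 ≤ meanFract μ Y u :=
  integral_nonneg fun _ => Int.fract_nonneg _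

theorem meanFract_eq_integral_map (hY : AEMeasurable Y μ) (u : ℝ) :
    meanFract μ Y u = ∫ y, Int.fract (y / u) ∂μ.map Y := by
  rw [meanFract, integral_map hY (Measurable.aestronglyMeasurable (by fun_prop))]

variable [IsProbabilityMeasure μ]

theorem measurable_meanFract (hY : AEMeasurable Y μ) : Measurable (meanFract μ Y) := by
  have : meanFract μ Y = fun u => ∫ y, Int.fract (y / u) ∂μ.map Y :=
    funext (meanFract_eq_integral_map hY)
  rw [this]
  have := Measure.isProbabilityMeasure_map hY
  exact StronglyMeasurable.measurable <| StronglyMeasurable.integral_prod_right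
    (f := fun u y : ℝ => Int.fract (y / u)) (Measurable.stronglyMeasurable (by fun_prop))

theorem integrable_fract_div (hY : AEMeasurable Y μ) (u : ℝ) :
    Integrable (fun ω => Int.fract (Y ω / u)) μ := by
  refine (integrable_const (1 : ℝ)).mono'
    (measurable_fract.comp_aemeasurable (hY.div_const u)).aestronglyMeasurable
    (ae_of_all _ fun ω => ?_)
  rw [Real.norm_of_nonneg (Int.fract_nonneg _)]
  exact (Int.fract_lt_one _).le

theorem meanFract_le_one (hY : AEMeasurable Y μ) (u : ℝ) : meanFract μ Y u ≤ 1 := by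
  have := integral_mono (integrable_fract_div hY u) (integrable_const (1 : ℝ))
    (fun ω => (Int.fract_lt_one _).le)
  exact this.trans (by simp)

theorem meanFract_le_div (hY0 : ∀ᵐ ω ∂μ, 0 ≤ Y ω) (hY : Integrable Y μ) {u : ℝ} (hu : 0 < u) :
    meanFract μ Y u ≤ (∫ ω, Y ω ∂μ) / u := by
  rw [← integral_div]
  refine integral_mono_ae (integrable_fract_div hY.aemeasurable u) (hY.div_const u) ?_
  filter_upwards [hY0] with ω hω
  exact sub_le_self _ (by exact_mod_cast Int.floor_nonneg.2 (div_nonneg hω hu.le))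

/-- Some event `0 < Y < n` is not null, and on it `{Y / u} = Y / u > 0` as soon as `u ≥ n`. -/
theorem exists_forall_meanFract_pos (hY0 : ∀ᵐ ω ∂μ, 0 ≤ Y ω) (hY : AEMeasurable Y μ)
    (hne : ¬ ∀ᵐ ω ∂μ, Y ω = 0) : ∃ R, ∀ u, R ≤ u → 0 < meanFract μ Y u := by
  obtain ⟨n, hn⟩ : ∃ n : ℕ, ¬ ∀ᵐ ω ∂μ, ¬ (0 < Y ω ∧ Y ω < n) := by
    by_contra hcon
    simp only [not_exists, not_not] at hcon
    refine hne ?_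
    filter_upwards [ae_all_iff.2 hcon, hY0] with ω h1 h2
    obtain ⟨n, hn⟩ := exists_nat_gt (Y ω)
    exact le_antisymm (not_lt.1 fun h => h1 n ⟨h, hn⟩) h2
  refine ⟨n, fun u hu => (meanFract_nonneg u).lt_of_ne fun h0 => hn ?_⟩
  rw [eq_comm, meanFract, integral_eq_zero_iff_of_nonneg (fun _ => Int.fract_nonneg _)
    (integrable_fract_div hY u)] at h0
  filter_upwards [h0] with ω hω h
  have hupos : 0 < u := (h.1.trans h.2).trans_le hu
  rw [Pi.zero_apply, Int.fract_eq_self.2 ⟨(div_pos h.1 hupos).le,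
    (div_lt_one hupos).2 (h.2.trans_le hu)⟩] at hω
  exact (div_pos h.1 hupos).ne' hω

/-- In logarithmic coordinates, the mean fractional part of `Y / X` with `X ∼ Γ(n+2,1)` is a
Gamma average of dilates of the mean fractional part of `Y`. -/
theorem exp_half_mul_meanFract_div {X : Ω → ℝ} (hY : AEMeasurable Y μ) {n : ℕ}
    (hX : HasLaw X (gammaMeasure ((n + 2 : ℕ) : ℝ) 1) μ) (hXY : IndepFun X Y μ) (v : ℝ) :
    Real.exp (v / 2) * meanFract μ (fun ω => Y ω / X ω) (Real.exp v) =
      gammaDilate (meanFract μ Y) n v / Real.Gamma ((n + 2 : ℕ) : ℝ) := by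
  have hpos : (0 : ℝ) < ((n + 2 : ℕ) : ℝ) := by positivity
  have := isProbabilityMeasure_gammaMeasure hpos one_pos
  have := Measure.isProbabilityMeasure_map hY
  set φ : ℝ × ℝ → ℝ := fun p => Int.fract (p.2 / p.1 / Real.exp v) with hφ
  have hφm : Measurable φ := by fun_prop
  have hlaw := hXY.hasLaw_prod hX ⟨hY, rfl⟩
  have hφi : Integrable φ ((gammaMeasure ((n + 2 : ℕ) : ℝ) 1).prod (μ.map Y)) := by
    refine (integrable_const (1 : ℝ)).mono' hφm.aestronglyMeasurable (ae_of_all _ fun p => ?_)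
    rw [Real.norm_of_nonneg (Int.fract_nonneg _)]
    exact (Int.fract_lt_one _).le
  have h1 : meanFract μ (fun ω => Y ω / X ω) (Real.exp v) =
      ∫ x, meanFract μ Y (x * Real.exp v) ∂gammaMeasure ((n + 2 : ℕ) : ℝ) 1 := by
    have h2 := hlaw.integral_comp (f := φ) hφm.aestronglyMeasurable
    rw [integral_prod _ hφi] at h2
    refine h2.trans (integral_congr_ae (ae_of_all _ fun x => ?_))
    simp only [hφ, meanFract_eq_integral_map hY, div_div]
  rw [h1, integral_gammaMeasure hpos, gammaDilate, ← integral_const_mul, ← integral_div]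
  refine setIntegral_congr_fun measurableSet_Ioi fun x hx => ?_
  have h3 : x ^ (((n + 2 : ℕ) : ℝ) - 1) = x ^ n * x := by
    rw [← pow_succ, ← Real.rpow_natCast]
    congr 1
    push_cast
    ring
  simp only [h3]
  ring

end MeanFract

/-! ### Density in `L²` and choice of coefficients. -/

section Approximation

/-- The functions `gammaDilate g n` span a dense subspace of `L²`. -/
theorem exists_sum_gammaDilate_close {g : ℝ → ℝ} {M R : ℝ} (hg : Measurable g)
    (hg0 : ∀ u, 0 ≤ g u) (hg1 : ∀ u, g u ≤ 1) (hM : 0 ≤ M) (hgM : ∀ u, 0 < u → g u ≤ M / u)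
    (hR : ∀ u, R ≤ u → 0 < g u) {f : ℝ → ℝ} (hf : MemLp f 2) {ε : ENNReal} (hε : 0 < ε) :
    ∃ (s : Finset ℕ) (l : ℕ → ℝ),
      eLpNorm (fun v => f v - ∑ n ∈ s, l n * gammaDilate g n v) 2 volume < ε := by
  have hmem := memLp_gammaDilate hg hg0 hg1 hM hgM
  set Φ : ℕ → Lp ℝ 2 (volume : Measure ℝ) := fun n => (hmem n).toLp with hΦ
  have hdense : (Submodule.span ℝ (Set.range Φ)).topologicalClosure = ⊤ := by
    rw [Submodule.topologicalClosure_eq_top_iff, Submodule.eq_bot_iff]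
    intro a ha
    have ha' : ∀ n, ∫ v, a v * gammaDilate g n v = 0 := by
      intro n
      have h1 := (Submodule.mem_orthogonal _ _).1 ha (Φ n) (Submodule.subset_span ⟨n, rfl⟩)
      rw [L2.inner_def] at h1
      rw [← h1]
      refine integral_congr_ae ?_
      filter_upwards [(hmem n).coeFn_toLp] with v hv
      rw [hΦ, hv]
      simp
    rw [Lp.eq_zero_iff_ae_eq_zero]
    exact ae_eq_zero_of_forall_gammaDilate hg hg0 hg1 hM hgM hR (Lp.stronglyMeasurable a).measurable
      (Lp.memLp a) ha'
  have hcl : hf.toLp ∈ closure (Submodule.span ℝ (Set.range Φ) : Set (Lp ℝ 2 volume)) := by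
    rw [← Submodule.topologicalClosure_coe, hdense]
    trivial
  obtain ⟨u, hu, hdist⟩ := EMetric.mem_closure_iff.1 hcl ε hε
  obtain ⟨c, rfl⟩ := Finsupp.mem_span_range_iff_exists_finsupp.1 hu
  refine ⟨c.support, c, ?_⟩
  refine lt_of_eq_of_lt ?_ hdist
  rw [edist_eq_enorm_sub, Lp.enorm_def]
  refine eLpNorm_congr_ae ?_
  have hall : ∀ᵐ v, ∀ n, (c n • Φ n : Lp ℝ 2 (volume : Measure ℝ)) v = c n * gammaDilate g n v := by
    refine ae_all_iff.2 fun n => ?_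
    filter_upwards [Lp.coeFn_smul (c n) (Φ n), (hmem n).coeFn_toLp] with v h1 h2
    rw [h1, Pi.smul_apply, hΦ, h2, smul_eq_mul]
  filter_upwards [Lp.coeFn_sub hf.toLp (c.sum fun i a => a • Φ i), hf.coeFn_toLp, hall,
    Lp.coeFn_finsetSum c.support fun n => c n • Φ n] with v h1 h2 h3 h4
  rw [h1, Pi.sub_apply, h2, Finsupp.sum, h4, Finset.sum_apply]
  simp only [h3]

theorem memLp_exp_half_mul_chi : MemLp (fun v => Real.exp (v / 2) * chi (Real.exp v)) 2 := by
  have hchi : Measurable chi := measurable_const.indicator measurableSet_Ioo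
  refine memLp_two_of_le_exp_neg_abs (c := 1 / 2) (C := 1) (by norm_num)
    (Measurable.aestronglyMeasurable (by fun_prop)) fun v => ?_
  by_cases hv : v < 0
  · have : chi (Real.exp v) = 1 :=
      Set.indicator_of_mem (Set.mem_Ioo.2 ⟨Real.exp_pos _, Real.exp_lt_one_iff.2 hv⟩) _
    rw [this, mul_one, one_mul, Real.abs_exp, abs_of_neg hv]
    exact le_of_eq (by ring_nf)
  · have : chi (Real.exp v) = 0 :=
      Set.indicator_of_notMem (fun h => hv (Real.exp_lt_one_iff.1 h.2)) _
    rw [this, mul_zero, abs_zero]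
    positivity

variable {Ω : Type*} [MeasurableSpace Ω] {μ : Measure Ω} {Z : ℕ → Ω → ℝ}

theorem sqDist_eq_eLpNorm_sq (c : ℕ → ℝ) (n : ℕ) :
    sqDist μ Z c n = eLpNorm (fun v => Real.exp (v / 2) * chi (Real.exp v) -
      ∑ k ∈ Finset.Icc 1 n, c k * (Real.exp (v / 2) * meanFract μ (Z k) (Real.exp v))) 2
        volume ^ 2 := by
  have h := eLpNorm_nnreal_pow_eq_lintegral (μ := (volume : Measure ℝ)) (p := 2)
    (f := fun v => Real.exp (v / 2) * chi (Real.exp v) -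
      ∑ k ∈ Finset.Icc 1 n, c k * (Real.exp (v / 2) * meanFract μ (Z k) (Real.exp v))) two_ne_zero
  simp only [NNReal.coe_ofNat, ENNReal.rpow_ofNat, ENNReal.coe_ofNat] at h
  rw [h, sqDist, lintegral_Ioi_eq_lintegral_exp]
  refine lintegral_congr fun v => ?_
  rw [← ENNReal.ofReal_mul (Real.exp_pos _).le, Real.enorm_eq_ofReal_abs,
    ← ENNReal.ofReal_pow (abs_nonneg _), sq_abs]
  congr 1
  have h2 : Real.exp v = Real.exp (v / 2) ^ 2 := by
    rw [← Real.exp_nat_mul]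
    push_cast
    ring_nf
  have h3 : ∑ k ∈ Finset.Icc 1 n, c k * (Real.exp (v / 2) * meanFract μ (Z k) (Real.exp v)) =
      Real.exp (v / 2) * ∑ k ∈ Finset.Icc 1 n, c k * meanFract μ (Z k) (Real.exp v) := by
    rw [Finset.mul_sum]
    exact Finset.sum_congr rfl fun k _ => by ring
  rw [h3, ← mul_sub, mul_pow, ← h2]

theorem verifiesGNB_of_forall_eventually
    (h : ∀ ε : ENNReal, 0 < ε → ∀ᶠ n in atTop, ∃ c, sqDist μ Z c n ≤ ε) : VerifiesGNB μ Z := by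
  set d : ℕ → ENNReal := fun n => ⨅ c, sqDist μ Z c n with hd
  have hd0 : Tendsto d atTop (𝓝 0) := by
    refine ENNReal.tendsto_nhds_zero.2 fun ε hε => ?_
    filter_upwards [h ε hε] with n ⟨c, hc⟩
    exact (iInf_le _ c).trans hc
  -- The infimum `d n` need not be attained, hence the slack `1 / n`, which is `⊤` at `n = 0`.
  have hex : ∀ n : ℕ, ∃ c, sqDist μ Z c n ≤ d n + ((n : ENNReal))⁻¹ := by
    intro n
    by_cases htop : d n = ⊤
    · exact ⟨0, by simp [htop]⟩
    · have : d n < d n + ((n : ENNReal))⁻¹ :=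
        ENNReal.lt_add_right htop (ENNReal.inv_ne_zero.2 (ENNReal.natCast_ne_top n))
      obtain ⟨c, hc⟩ := iInf_lt_iff.1 this
      exact ⟨c, hc.le⟩
  choose c hc using hex
  refine ⟨c, tendsto_of_tendsto_of_tendsto_of_le_of_le tendsto_const_nhds ?_
    (fun _ => zero_le) hc⟩
  simpa using hd0.add ENNReal.tendsto_inv_nat_nhds_zero

end Approximation

/-! ### The two assertions. -/

section Main

variable {Ω : Type*} [MeasurableSpace Ω] {μ : Measure Ω} {Y : Ω → ℝ}

theorem moment_div_gamma {X : Ω → ℝ} {α k : ℝ} (hY0 : ∀ᵐ ω ∂μ, 0 ≤ Y ω)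
    (hYα : Integrable (fun ω => Y ω ^ α) μ) (hk : 0 < k) (hα : α < k)
    (hX : HasLaw X (gammaMeasure k 1) μ) (hXY : IndepFun X Y μ) :
    Integrable (fun ω => (Y ω / X ω) ^ α) μ ∧
      ∫ ω, (Y ω / X ω) ^ α ∂μ = Real.Gamma (k - α) / Real.Gamma k * ∫ ω, Y ω ^ α ∂μ := by
  have hXpos : ∀ᵐ ω ∂μ, 0 < X ω :=
    ae_of_ae_map hX.aemeasurable (hX.map_eq ▸ ae_gammaMeasure_pos k)
  have heq : (fun ω => (Y ω / X ω) ^ α) =ᵐ[μ] (fun ω => X ω ^ (-α)) * fun ω => Y ω ^ α := by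
    filter_upwards [hXpos, hY0] with ω h1 h2
    rw [Pi.mul_apply, Real.div_rpow h2 h1.le, Real.rpow_neg h1.le]
    ring
  obtain ⟨hi, hv⟩ := gammaMeasure_rpow_neg hk hα
  have hXi : Integrable (fun ω => X ω ^ (-α)) μ := by
    rw [← hX.map_eq] at hi
    exact hi.comp_aemeasurable hX.aemeasurable
  have hXv : ∫ ω, X ω ^ (-α) ∂μ = Real.Gamma (k - α) / Real.Gamma k :=
    (hX.integral_comp hi.aestronglyMeasurable).trans hv
  have hind : IndepFun (fun ω => X ω ^ (-α)) (fun ω => Y ω ^ α) μ :=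
    hXY.comp (φ := fun x : ℝ => x ^ (-α)) (ψ := fun y : ℝ => y ^ α) (by fun_prop) (by fun_prop)
  constructor
  · exact (hind.integrable_mul hXi hYα).congr heq.symm
  · rw [integral_congr_ae heq,
      hind.integral_mul_eq_mul_integral hXi.aestronglyMeasurable hYα.aestronglyMeasurable, hXv]

theorem verifiesGNB_div_gamma [IsProbabilityMeasure μ] {X : ℕ → Ω → ℝ} (hY0 : ∀ᵐ ω ∂μ, 0 ≤ Y ω) (hY : Integrable Y μ)
    (hne : ¬ ∀ᵐ ω ∂μ, Y ω = 0)
    (hX : ∀ k : ℕ, 1 ≤ k → HasLaw (X k) (gammaMeasure (k : ℝ) 1) μ)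
    (hXY : ∀ k : ℕ, 1 ≤ k → IndepFun (X k) Y μ) :
    VerifiesGNB μ (fun k ω => Y ω / X k ω) := by
  refine verifiesGNB_of_forall_eventually fun ε hε => ?_
  obtain ⟨δ, hδ, hδε⟩ : ∃ δ : ENNReal, 0 < δ ∧ δ ^ 2 ≤ ε := by
    refine ⟨min ε 1, lt_min hε one_pos, ?_⟩
    rw [sq]
    exact (mul_le_mul' (min_le_left _ _) (min_le_right _ _)).trans (mul_one _).le
  obtain ⟨R, hR⟩ := exists_forall_meanFract_pos hY0 hY.aemeasurable hne
  obtain ⟨s, l, hl⟩ := exists_sum_gammaDilate_close (measurable_meanFract hY.aemeasurable)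
    meanFract_nonneg (meanFract_le_one hY.aemeasurable) (integral_nonneg_of_ae hY0)
    (fun u hu => meanFract_le_div hY0 hY hu) hR memLp_exp_half_mul_chi hδ
  have hsub : ∀ᶠ n in atTop, ∀ m ∈ s, m + 2 ≤ n :=
    (Finset.eventually_all s).2 fun m _ => eventually_ge_atTop _
  filter_upwards [hsub] with n hn
  -- The index `m` of `gammaDilate` corresponds to `k = m + 2`, and `Γ(k)` undoes the normalisation
  -- of the density. All other coefficients, including that of `k = 1`, are zero.
  set c : ℕ → ℝ := fun k => if k ∈ s.image (· + 2) then l (k - 2) * Real.Gamma k else 0 with hc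
  refine ⟨c, ?_⟩
  rw [sqDist_eq_eLpNorm_sq]
  refine le_trans ?_ hδε
  gcongr
  refine le_of_eq_of_le ?_ hl.le
  congr 1
  ext v
  congr 1
  have himage : s.image (· + 2) ⊆ Finset.Icc 1 n := by
    intro k hk
    obtain ⟨m, hm, rfl⟩ := Finset.mem_image.1 hk
    exact Finset.mem_Icc.2 ⟨by omega, hn m hm⟩
  rw [← Finset.sum_subset himage fun k _ hk => by simp only [hc, if_neg hk, zero_mul],
    Finset.sum_image fun _ _ _ _ h => by simpa using h]
  refine Finset.sum_congr rfl fun m hm => ?_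
  have hcm : c (m + 2) = l m * Real.Gamma ((m + 2 : ℕ) : ℝ) := by
    simp only [hc, if_pos (Finset.mem_image_of_mem (· + 2) hm), Nat.add_sub_cancel]
  have hG : Real.Gamma ((m + 2 : ℕ) : ℝ) ≠ 0 := (Real.Gamma_pos_of_pos (by positivity)).ne'
  rw [hcm, exp_half_mul_meanFract_div hY.aemeasurable (hX _ (by omega)) (hXY _ (by omega))]
  field_simp

theorem exists_moment_bound {X : ℕ → Ω → ℝ} {α : ℝ} (hY0 : ∀ᵐ ω ∂μ, 0 ≤ Y ω)
    (hα : 1 ≤ α) (hYα : Integrable (fun ω => Y ω ^ α) μ)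
    (hX : ∀ k : ℕ, 1 ≤ k → HasLaw (X k) (gammaMeasure (k : ℝ) 1) μ)
    (hXY : ∀ k : ℕ, 1 ≤ k → IndepFun (X k) Y μ) :
    ∃ C : ℝ, ∀ k : ℕ, α < (k : ℝ) →
      Integrable (fun ω => (Y ω / X k ω) ^ α) μ ∧
      ∫ ω, (Y ω / X k ω) ^ α ∂μ ≤ C * (1 / (k : ℝ) ^ α) := by
  -- `N` is the least integer above `α`, so every admissible `k` satisfies `k ≥ N`; hence `α / k ≤ α
  -- / N`, that is, `k - α ≥ δ k` with `δ = 1 - α / N`.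
  set N : ℝ := (⌊α⌋₊ : ℝ) + 1 with hN
  have hNα : α < N := Nat.lt_floor_add_one α
  have hNpos : 0 < N := by positivity
  set δ : ℝ := (N - α) / N with hδ
  have hδpos : 0 < δ := div_pos (sub_pos.2 hNα) hNpos
  refine ⟨(δ ^ α)⁻¹ * ∫ ω, Y ω ^ α ∂μ, fun k hk => ?_⟩
  have hkpos : (0 : ℝ) < k := by linarith
  have hk1 : 1 ≤ k := by exact_mod_cast hkpos
  obtain ⟨h1, h2⟩ := moment_div_gamma hY0 hYα hkpos hk (hX k hk1) (hXY k hk1)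
  refine ⟨h1, ?_⟩
  have hYnn : 0 ≤ ∫ ω, Y ω ^ α ∂μ := integral_nonneg_of_ae <| by
    filter_upwards [hY0] with ω hω
    exact Real.rpow_nonneg hω α
  have hNk : N ≤ k := by
    have : ⌊α⌋₊ < k := (Nat.floor_lt (by linarith)).2 hk
    rw [hN]
    exact_mod_cast this
  have hx : 0 < (k : ℝ) - α := sub_pos.2 hk
  have hδk : δ * k ≤ k - α := by
    rw [hδ, div_mul_eq_mul_div, div_le_iff₀ hNpos]
    nlinarith
  have hG := Gamma_mul_rpow_le hx hα
  rw [sub_add_cancel] at hG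
  have hGk : 0 < Real.Gamma k := Real.Gamma_pos_of_pos hkpos
  have hGx : 0 < Real.Gamma (k - α) := Real.Gamma_pos_of_pos hx
  rw [h2]
  calc Real.Gamma (k - α) / Real.Gamma k * ∫ ω, Y ω ^ α ∂μ
      ≤ ((δ * k) ^ α)⁻¹ * ∫ ω, Y ω ^ α ∂μ := by
        gcongr
        rw [inv_eq_one_div, div_le_div_iff₀ hGk (by positivity), one_mul]
        refine le_trans ?_ hG
        gcongr
    _ = _ := by
        rw [Real.mul_rpow hδpos.le hkpos.le, mul_inv]
        ring

end Main

theorem theorem3 {Ω : Type*} [MeasurableSpace Ω] (μ : Measure Ω) [IsProbabilityMeasure μ]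
    (Y : Ω → ℝ) (X : ℕ → Ω → ℝ)
    (hY_nonneg : ∀ᵐ ω ∂μ, 0 ≤ Y ω)
    (hY_int : Integrable Y μ)
    (hY_ne : ¬ (∀ᵐ ω ∂μ, Y ω = 0))
    (hX_law : ∀ k : ℕ, 1 ≤ k → HasLaw (X k) (gammaMeasure (k : ℝ) 1) μ)
    (hXY : ∀ k : ℕ, 1 ≤ k → IndepFun (X k) Y μ) :
    VerifiesGNB μ (fun k ω => Y ω / X k ω) ∧
    ∀ α : ℝ, 1 ≤ α → Integrable (fun ω => Y ω ^ α) μ →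
      ∃ C : ℝ, ∀ k : ℕ, α < (k : ℝ) →
        Integrable (fun ω => (Y ω / X k ω) ^ α) μ ∧
        ∫ ω, (Y ω / X k ω) ^ α ∂μ ≤ C * (1 / (k : ℝ) ^ α) := by
  exact ⟨verifiesGNB_div_gamma hY_nonneg hY_int hY_ne hX_law hXY,
    fun α hα hYα => exists_moment_bound hY_nonneg hα hYα hX_law hXY⟩
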